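/- All games are short two-player combinatorial games under normal play. A game form $G=\{G^{\mathcal L}\mid G^{\mathcal R}\}$ is built recursively from finitely many Left options and finitely many Right options. The order is given by: $G\leqslant H$ if and only if there is no Left option $G^L$ with $H\leqslant G^L$ and no Right option $H^R$ with $H^R\leqslant G$; and $G=H$ means that $G\leqslant H$ and $H\leqslant G$. The disjunctive sum is $G+H=\{G^{\mathcal L}+H,\ G+H^{\mathcal L}\mid G^{\mathcal R}+H,\ G+H^{\mathcal R}\}$. The canonical form of $G$ is the unique form that is equal to $G$ and has no dominated and no reversible options at any of its positions, and the birthday $b(G)$ is the height of the game tree of the canonical form of $G$. A game $G$ is decomposable if there are games $H$ and $J$ with $b(H)<b(G)$, $b(J)<b(G)$ and $G=H+J$; otherwise $G$ is indecomposable. For a nonnegative integer $k$, the nimber of size $k$ is $*k=\{*0,\ldots,*(k-1)\mid *0,\ldots,*(k-1)\}$. Theorem. Let $k\geqslant 1$ be an integer. Then $*k$ is indecomposable if and only if $k$ is a power of $2$, that is, $k=2^n$ for some integer $n\geqslant 0$. -/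

import Mathlib

/-- Forms of short games: `mk m n L R` is the form `{L 0, …, L (m-1) | R 0, …, R (n-1)}`. -/
inductive GameForm : Type
  | mk (m n : ℕ) (L : Fin m → GameForm) (R : Fin n → GameForm) : GameForm

namespace GameForm

/-- The number of Left options. -/
def leftCard : GameForm → ℕ
  | mk m _ _ _ => m

/-- The number of Right options. -/
def rightCard : GameForm → ℕ
  | mk _ n _ _ => n

/-- The Left options. -/
def left : (G : GameForm) → Fin G.leftCard → GameForm
  | mk _ _ L _ => L

/-- The Right options. -/
def right : (G : GameForm) → Fin G.rightCard → GameForm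
  | mk _ _ _ R => R

/-- The height of the game tree of a form (its formal birthday): `0` for the form `{ | }`, and
otherwise one more than the largest height of an option. -/
def height : GameForm → ℕ
  | mk _ _ L R =>
    max (Finset.univ.sup fun i => height (L i) + 1) (Finset.univ.sup fun j => height (R j) + 1)

theorem height_left_lt (G : GameForm) (i : Fin G.leftCard) : (G.left i).height < G.height := by
  cases G with
  | mk m n L R =>
    have h := Finset.le_sup (f := fun i => height (L i) + 1) (Finset.mem_univ i)
    simp only [height, left]
    exact lt_of_lt_of_le (Nat.lt_succ_self _) (le_trans h (le_max_left _ _))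

theorem height_right_lt (G : GameForm) (j : Fin G.rightCard) :
    (G.right j).height < G.height := by
  cases G with
  | mk m n L R =>
    have h := Finset.le_sup (f := fun j => height (R j) + 1) (Finset.mem_univ j)
    simp only [height, right]
    exact lt_of_lt_of_le (Nat.lt_succ_self _) (le_trans h (le_max_right _ _))

theorem height_le_iff (G : GameForm) (b : ℕ) :
    G.height ≤ b ↔ (∀ i, (G.left i).height < b) ∧ ∀ j, (G.right j).height < b := by
  cases G with
  | mk m n L R =>
    simp only [height, left, right, max_le_iff, Finset.sup_le_iff, Finset.mem_univ, true_implies]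
    rfl

/-- The order on game forms: `G ≤ H` if and only if there is no Left option `Gᴸ` with `H ≤ Gᴸ`
and no Right option `Hᴿ` with `Hᴿ ≤ G`. -/
protected def le (G H : GameForm) : Prop :=
  (∀ i : Fin G.leftCard, ¬ GameForm.le H (G.left i)) ∧
    (∀ j : Fin H.rightCard, ¬ GameForm.le (H.right j) G)
termination_by G.height + H.height
decreasing_by
  · have := height_left_lt G i; omega
  · have := height_right_lt H j; omega

instance : LE GameForm := ⟨GameForm.le⟩

theorem le_iff (G H : GameForm) :
    G ≤ H ↔ (∀ i, ¬ H ≤ G.left i) ∧ (∀ j, ¬ H.right j ≤ G) := by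
  change GameForm.le G H ↔ _
  rw [GameForm.le]
  rfl

/-- Equality of game values, `G = H` in the sense of combinatorial game theory:
`G ≤ H` and `H ≤ G`. -/
def Equal (G H : GameForm) : Prop := G ≤ H ∧ H ≤ G

/-- The disjunctive sum `G + H = {Gᴸ + H, G + Hᴸ | Gᴿ + H, G + Hᴿ}`. -/
protected def add (G H : GameForm) : GameForm :=
  mk (G.leftCard + H.leftCard) (G.rightCard + H.rightCard)
    (Fin.append (fun i => GameForm.add (G.left i) H) (fun i => GameForm.add G (H.left i)))
    (Fin.append (fun j => GameForm.add (G.right j) H) (fun j => GameForm.add G (H.right j)))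
termination_by G.height + H.height
decreasing_by
  · have := height_left_lt G i; omega
  · have := height_left_lt H i; omega
  · have := height_right_lt G j; omega
  · have := height_right_lt H j; omega

instance : Add GameForm := ⟨GameForm.add⟩

theorem add_def (G H : GameForm) :
    G + H = mk (G.leftCard + H.leftCard) (G.rightCard + H.rightCard)
      (Fin.append (fun i => G.left i + H) (fun i => G + H.left i))
      (Fin.append (fun j => G.right j + H) (fun j => G + H.right j)) := by
  change GameForm.add G H = _
  rw [GameForm.add]
  rfl

/-- The nimber `*n = {*0, …, *(n-1) | *0, …, *(n-1)}`. -/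
def nimber (n : ℕ) : GameForm :=
  mk n n (fun i => nimber i.1) (fun i => nimber i.1)
termination_by n
decreasing_by
  · exact i.2
  · exact i.2

/-- A form is canonical if no two distinct Left options are comparable and no two distinct Right
options are comparable (that is, there are no dominated options), no Left option `Gᴸ` has a Right
option `Gᴸᴿ ≤ G` and no Right option `Gᴿ` has a Left option `Gᴿᴸ ≥ G` (that is, there are no
reversible options), and all its options are canonical. -/
def IsCanonical (G : GameForm) : Prop :=
  (∀ i i', i ≠ i' → ¬ G.left i ≤ G.left i') ∧
  (∀ j j', j ≠ j' → ¬ G.right j ≤ G.right j') ∧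
  (∀ i k, ¬ (G.left i).right k ≤ G) ∧
  (∀ j k, ¬ G ≤ (G.right j).left k) ∧
  (∀ i : Fin G.leftCard, IsCanonical (G.left i)) ∧
  (∀ j : Fin G.rightCard, IsCanonical (G.right j))
termination_by G.height
decreasing_by
  · exact height_left_lt G i
  · exact height_right_lt G j

/-! Every form equals a canonical form, and the height of that canonical form is unique. -/

theorem le_refl' (G : GameForm) : G ≤ G := by
  induction hn : G.height using Nat.strong_induction_on generalizing G with
  | _ n ih =>
    subst hn
    refine (le_iff G G).2 ⟨fun i h => ?_, fun j h => ?_⟩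
    · exact ((le_iff _ _).1 h).1 i (ih _ (height_left_lt G i) _ rfl)
    · exact ((le_iff _ _).1 h).2 j (ih _ (height_right_lt G j) _ rfl)

theorem le_trans' (G H K : GameForm) (h₁ : G ≤ H) (h₂ : H ≤ K) : G ≤ K := by
  induction hn : G.height + H.height + K.height using Nat.strong_induction_on
    generalizing G H K with
  | _ n ih =>
    subst hn
    refine (le_iff G K).2 ⟨fun i h => ?_, fun j h => ?_⟩
    · have := height_left_lt G i
      exact ((le_iff _ _).1 h₁).1 i (ih _ (by omega) H K (G.left i) h₂ h rfl)
    · have := height_right_lt K j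
      exact ((le_iff _ _).1 h₂).2 j (ih _ (by omega) (K.right j) G H h h₁ rfl)

theorem not_le_left (G : GameForm) (i : Fin G.leftCard) : ¬ G ≤ G.left i :=
  ((le_iff G G).1 (le_refl' G)).1 i

theorem not_right_le (G : GameForm) (j : Fin G.rightCard) : ¬ G.right j ≤ G :=
  ((le_iff G G).1 (le_refl' G)).2 j

theorem Equal.refl (G : GameForm) : Equal G G := ⟨le_refl' G, le_refl' G⟩

theorem Equal.symm {G H : GameForm} (h : Equal G H) : Equal H G := ⟨h.2, h.1⟩

theorem Equal.trans {G H K : GameForm} (h : Equal G H) (h' : Equal H K) : Equal G K :=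
  ⟨le_trans' _ _ _ h.1 h'.1, le_trans' _ _ _ h'.2 h.2⟩

/-- The number of nodes of the game tree. -/
def nodes : GameForm → ℕ
  | mk _ _ L R => 1 + ∑ i, nodes (L i) + ∑ j, nodes (R j)

theorem nodes_eq (G : GameForm) :
    G.nodes = 1 + ∑ i, (G.left i).nodes + ∑ j, (G.right j).nodes := by
  cases G with
  | mk m n L R => rfl

/-- The form whose Left and Right options are the members of two given lists. -/
def ofLists (l r : List GameForm) : GameForm := mk l.length r.length l.get r.get

theorem nodes_ofLists (l r : List GameForm) :
    (ofLists l r).nodes = 1 + (l.map nodes).sum + (r.map nodes).sum := by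
  have h : ∀ l : List GameForm, ∑ i, nodes (l.get i) = (l.map nodes).sum := fun l => by
    rw [← List.sum_ofFn, List.ofFn_comp' l.get nodes]
    simp
  simp only [ofLists, nodes, h]

theorem forall_left_ofLists (l r : List GameForm) (P : GameForm → Prop) :
    (∀ i, P ((ofLists l r).left i)) ↔ ∀ X ∈ l, P X := by
  simp only [List.forall_mem_iff_get]
  rfl

theorem forall_right_ofLists (l r : List GameForm) (P : GameForm → Prop) :
    (∀ j, P ((ofLists l r).right j)) ↔ ∀ X ∈ r, P X := by
  simp only [List.forall_mem_iff_get]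
  rfl

theorem ofLists_le_iff (l r : List GameForm) (H : GameForm) :
    ofLists l r ≤ H ↔ (∀ X ∈ l, ¬ H ≤ X) ∧ ∀ j, ¬ H.right j ≤ ofLists l r := by
  rw [le_iff, forall_left_ofLists l r (fun X => ¬ H ≤ X)]

theorem le_ofLists_iff (l r : List GameForm) (H : GameForm) :
    H ≤ ofLists l r ↔ (∀ i, ¬ ofLists l r ≤ H.left i) ∧ ∀ X ∈ r, ¬ X ≤ H := by
  rw [le_iff, forall_right_ofLists l r (fun X => ¬ X ≤ H)]

/-- The members of a finite family other than the one with index `i`. -/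
def others {m : ℕ} (L : Fin m → GameForm) (i : Fin m) : List GameForm :=
  ((List.finRange m).erase i).map L

theorem mem_others {m : ℕ} (L : Fin m → GameForm) (i : Fin m) (X : GameForm) :
    X ∈ others L i ↔ ∃ i', i' ≠ i ∧ L i' = X := by
  simp [others, (List.nodup_finRange m).mem_erase_iff]

theorem sum_others {m : ℕ} (L : Fin m → GameForm) (i : Fin m) :
    ((others L i).map nodes).sum + (L i).nodes = ∑ i', (L i').nodes := by
  have h := List.sum_map_erase (fun x => (L x).nodes) (List.mem_finRange i)
  have h2 : ∑ i', (L i').nodes = ((List.finRange m).map fun x => (L x).nodes).sum := by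
    rw [← List.sum_ofFn, List.ofFn_eq_map]
  rw [h2, ← h, others, List.map_map, add_comm]
  rfl

/-- Replace the Left option with index `i` by the members of a list. -/
def replaceLeft (G : GameForm) (i : Fin G.leftCard) (M : List GameForm) : GameForm :=
  ofLists (others G.left i ++ M) (List.ofFn G.right)

/-- Replace the Right option with index `j` by the members of a list. -/
def replaceRight (G : GameForm) (j : Fin G.rightCard) (M : List GameForm) : GameForm :=
  ofLists (List.ofFn G.left) (others G.right j ++ M)

theorem nodes_replaceLeft (G : GameForm) (i : Fin G.leftCard) (M : List GameForm)
    (hM : (M.map nodes).sum < (G.left i).nodes) : (G.replaceLeft i M).nodes < G.nodes := by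
  have h := sum_others G.left i
  rw [replaceLeft, nodes_ofLists, nodes_eq G, List.map_append, List.sum_append, List.map_ofFn,
    List.sum_ofFn]
  simp only [Function.comp_apply]
  omega

theorem nodes_replaceRight (G : GameForm) (j : Fin G.rightCard) (M : List GameForm)
    (hM : (M.map nodes).sum < (G.right j).nodes) : (G.replaceRight j M).nodes < G.nodes := by
  have h := sum_others G.right j
  rw [replaceRight, nodes_ofLists, nodes_eq G, List.map_append, List.sum_append, List.map_ofFn,
    List.sum_ofFn]
  simp only [Function.comp_apply]
  omega

theorem replaceLeft_equal (G : GameForm) (i : Fin G.leftCard) (M : List GameForm)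
    (h₁ : ∀ X ∈ M, ¬ G ≤ X)
    (h₂ : (∀ X ∈ others G.left i ++ M, ¬ G.replaceLeft i M ≤ X) →
      (∀ j, ¬ G.right j ≤ G.replaceLeft i M) → ¬ G.replaceLeft i M ≤ G.left i) :
    Equal (G.replaceLeft i M) G := by
  have hs := le_refl' (G.replaceLeft i M)
  have hl := ((ofLists_le_iff _ _ _).1 hs).1
  have hr : ∀ j, ¬ G.right j ≤ G.replaceLeft i M := fun j =>
    ((le_ofLists_iff _ _ _).1 hs).2 _ (by simp)
  constructor
  · refine (ofLists_le_iff _ _ _).2 ⟨fun X hX => ?_, hr⟩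
    rcases List.mem_append.1 hX with hX | hX
    · obtain ⟨i', -, rfl⟩ := (mem_others _ _ _).1 hX
      exact not_le_left G i'
    · exact h₁ X hX
  · refine (le_ofLists_iff _ _ _).2 ⟨fun i' => ?_, fun X hX => ?_⟩
    · by_cases h : i' = i
      · subst h
        exact h₂ hl hr
      · exact hl _ (List.mem_append_left _ ((mem_others _ _ _).2 ⟨i', h, rfl⟩))
    · obtain ⟨j, rfl⟩ := (List.mem_ofFn' _ _).1 hX
      exact not_right_le G j

theorem replaceRight_equal (G : GameForm) (j : Fin G.rightCard) (M : List GameForm)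
    (h₁ : ∀ X ∈ M, ¬ X ≤ G)
    (h₂ : (∀ X ∈ others G.right j ++ M, ¬ X ≤ G.replaceRight j M) →
      (∀ i, ¬ G.replaceRight j M ≤ G.left i) → ¬ G.right j ≤ G.replaceRight j M) :
    Equal (G.replaceRight j M) G := by
  have hs := le_refl' (G.replaceRight j M)
  have hr := ((le_ofLists_iff _ _ _).1 hs).2
  have hl : ∀ i, ¬ G.replaceRight j M ≤ G.left i := fun i =>
    ((ofLists_le_iff _ _ _).1 hs).1 _ (by simp)
  constructor
  · refine (ofLists_le_iff _ _ _).2 ⟨fun X hX => ?_, fun j' => ?_⟩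
    · obtain ⟨i, rfl⟩ := (List.mem_ofFn' _ _).1 hX
      exact not_le_left G i
    · by_cases h : j' = j
      · subst h
        exact h₂ hr hl
      · exact hr _ (List.mem_append_left _ ((mem_others _ _ _).2 ⟨j', h, rfl⟩))
  · refine (le_ofLists_iff _ _ _).2 ⟨hl, fun X hX => ?_⟩
    rcases List.mem_append.1 hX with hX | hX
    · obtain ⟨j', -, rfl⟩ := (mem_others _ _ _).1 hX
      exact not_right_le G j'
    · exact h₁ X hX

theorem nodes_pos (G : GameForm) : 0 < G.nodes := by
  rw [nodes_eq]; omega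

/-- A form with the fewest nodes among the forms of its value is canonical. -/
theorem isCanonical_of_minimal (G : GameForm) (hG : ∀ K, Equal K G → G.nodes ≤ K.nodes) :
    IsCanonical G := by
  induction hn : G.height using Nat.strong_induction_on generalizing G with
  | _ n ih =>
    subst hn
    rw [IsCanonical]
    refine ⟨fun i i' hi h => ?_, fun j j' hj h => ?_, fun i k h => ?_, fun j k h => ?_,
      fun i => ?_, fun j => ?_⟩
    · refine absurd (hG _ (replaceLeft_equal G i [] (by simp) fun hl _ h' => ?_))
        (not_le.2 (nodes_replaceLeft G i [] (by simpa using nodes_pos _)))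
      exact hl _ (List.mem_append_left _ ((mem_others _ _ _).2 ⟨i', hi.symm, rfl⟩))
        (le_trans' _ _ _ h' h)
    · refine absurd (hG _ (replaceRight_equal G j' [] (by simp) fun hr _ h' => ?_))
        (not_le.2 (nodes_replaceRight G j' [] (by simpa using nodes_pos _)))
      exact hr _ (List.mem_append_left _ ((mem_others _ _ _).2 ⟨j, hj, rfl⟩))
        (le_trans' _ _ _ h h')
    · refine absurd (hG _ (replaceLeft_equal G i (List.ofFn ((G.left i).right k).left)
        (fun X hX h' => ?_) fun hl hr h' => ?_))
        (not_le.2 (nodes_replaceLeft G i _ ?_))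
      · obtain ⟨a, rfl⟩ := (List.mem_ofFn' _ _).1 hX
        exact not_le_left _ a (le_trans' _ _ _ h h')
      · refine ((le_iff _ _).1 h').2 k ((le_iff _ _).2 ⟨fun a => ?_, fun b hb => ?_⟩)
        · exact hl _ (List.mem_append_right _ (by simp))
        · obtain ⟨j, hj⟩ := (List.mem_ofFn' _ _).1 (List.get_mem (List.ofFn G.right) b)
          refine ((le_iff _ _).1 h).2 j ?_
          rw [hj]
          exact hb
      · rw [List.map_ofFn, List.sum_ofFn, nodes_eq (G.left i)]
        have h1 := nodes_eq ((G.left i).right k)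
        have h2 := Finset.single_le_sum (f := fun k => ((G.left i).right k).nodes)
          (fun _ _ => Nat.zero_le _) (Finset.mem_univ k)
        simp only [Function.comp_apply] at *
        omega
    · refine absurd (hG _ (replaceRight_equal G j (List.ofFn ((G.right j).left k).right)
        (fun X hX h' => ?_) fun hr hl h' => ?_))
        (not_le.2 (nodes_replaceRight G j _ ?_))
      · obtain ⟨a, rfl⟩ := (List.mem_ofFn' _ _).1 hX
        exact not_right_le _ a (le_trans' _ _ _ h' h)
      · refine ((le_iff _ _).1 h').1 k ((le_iff _ _).2 ⟨fun b hb => ?_, fun a => ?_⟩)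
        · obtain ⟨i, hi⟩ := (List.mem_ofFn' _ _).1 (List.get_mem (List.ofFn G.left) b)
          refine ((le_iff _ _).1 h).1 i ?_
          rw [hi]
          exact hb
        · exact hr _ (List.mem_append_right _ (by simp))
      · rw [List.map_ofFn, List.sum_ofFn, nodes_eq (G.right j)]
        have h1 := nodes_eq ((G.right j).left k)
        have h2 := Finset.single_le_sum (f := fun k => ((G.right j).left k).nodes)
          (fun _ _ => Nat.zero_le _) (Finset.mem_univ k)
        simp only [Function.comp_apply] at *
        omega
    · refine ih _ (height_left_lt G i) _ (fun K hK => ?_) rfl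
      by_contra hlt
      refine absurd (hG _ (replaceLeft_equal G i [K] (fun X hX h' => ?_) fun hl _ h' => ?_))
        (not_le.2 (nodes_replaceLeft G i [K] (by simpa using hlt)))
      · rw [List.mem_singleton.1 hX] at h'
        exact not_le_left G i (le_trans' _ _ _ h' hK.1)
      · exact hl K (by simp) (le_trans' _ _ _ h' hK.2)
    · refine ih _ (height_right_lt G j) _ (fun K hK => ?_) rfl
      by_contra hlt
      refine absurd (hG _ (replaceRight_equal G j [K] (fun X hX h' => ?_) fun hr _ h' => ?_))
        (not_le.2 (nodes_replaceRight G j [K] (by simpa using hlt)))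
      · rw [List.mem_singleton.1 hX] at h'
        exact not_right_le G j (le_trans' _ _ _ hK.2 h')
      · exact hr K (by simp) (le_trans' _ _ _ hK.1 h')

theorem exists_canonical (G : GameForm) : ∃ K, IsCanonical K ∧ Equal K G := by
  obtain ⟨K, hK, hmin⟩ := WellFounded.has_min (measure nodes).wf {K | Equal K G}
    ⟨G, Equal.refl G⟩
  exact ⟨K, isCanonical_of_minimal K fun K' hK' => not_lt.1 (hmin K' (hK'.trans hK)), hK⟩

theorem IsCanonical.height_le {G H : GameForm} (hG : IsCanonical G) (hH : IsCanonical H)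
    (h : Equal G H) : G.height ≤ H.height := by
  induction hn : G.height + H.height using Nat.strong_induction_on generalizing G H with
  | _ n ih =>
    subst hn
    rw [IsCanonical] at hG hH
    obtain ⟨gl, gr, grl, grr, gcl, gcr⟩ := hG
    obtain ⟨hl, hr, hrl, hrr, hcl, hcr⟩ := hH
    refine (height_le_iff _ _).2 ⟨fun i => ?_, fun j => ?_⟩
    · have h1 := ((le_iff _ _).1 h.1).1 i
      rw [le_iff, not_and_or] at h1
      push Not at h1
      rcases h1 with ⟨i', h1⟩ | ⟨k, h1⟩
      · have h2 := ((le_iff _ _).1 h.2).1 i'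
        rw [le_iff, not_and_or] at h2
        push Not at h2
        rcases h2 with ⟨a, h2⟩ | ⟨k, h2⟩
        · have hia : i = a := by
            by_contra hne
            exact gl i a hne (le_trans' _ _ _ h1 h2)
          subst hia
          have a1 := height_left_lt G i
          have a2 := height_left_lt H i'
          have := ih _ (by omega) (gcl i) (hcl i') ⟨h1, h2⟩ rfl
          omega
        · exact absurd (le_trans' _ _ _ h2 h.1) (hrl i' k)
      · exact absurd (le_trans' _ _ _ h1 h.2) (grl i k)
    · have h1 := ((le_iff _ _).1 h.2).2 j
      rw [le_iff, not_and_or] at h1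
      push Not at h1
      rcases h1 with ⟨k, h1⟩ | ⟨j', h1⟩
      · exact absurd (le_trans' _ _ _ h.1 h1) (grr j k)
      · have h2 := ((le_iff _ _).1 h.1).2 j'
        rw [le_iff, not_and_or] at h2
        push Not at h2
        rcases h2 with ⟨k, h2⟩ | ⟨a, h2⟩
        · exact absurd (le_trans' _ _ _ h.2 h2) (hrr j' k)
        · have hja : a = j := by
            by_contra hne
            exact gr a j hne (le_trans' _ _ _ h2 h1)
          subst hja
          have a1 := height_right_lt G a
          have a2 := height_right_lt H j'
          have := ih _ (by omega) (gcr a) (hcr j') ⟨h2, h1⟩ rfl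
          omega

/-- A canonical form of the value of `G`. -/
noncomputable def canonicalForm (G : GameForm) : GameForm := (exists_canonical G).choose

theorem canonicalForm_spec (G : GameForm) :
    IsCanonical G.canonicalForm ∧ Equal G.canonicalForm G := (exists_canonical G).choose_spec

/-- The birthday `b(G)`: the height of the game tree of the canonical form of `G`. -/
noncomputable def birthday (G : GameForm) : ℕ := G.canonicalForm.height

theorem birthday_eq (G K : GameForm) (hK : IsCanonical K) (h : Equal K G) :
    G.birthday = K.height :=
  le_antisymm
    ((canonicalForm_spec G).1.height_le hK ((canonicalForm_spec G).2.trans h.symm))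
    (hK.height_le (canonicalForm_spec G).1 (h.trans (canonicalForm_spec G).2.symm))

/-- `G` is decomposable if `G = H + J` for some `H`, `J` with `b(H) < b(G)` and `b(J) < b(G)`. -/
def Decomposable (G : GameForm) : Prop :=
  ∃ H J : GameForm, H.birthday < G.birthday ∧ J.birthday < G.birthday ∧ Equal G (H + J)

/-- `G` is indecomposable if it is not decomposable. -/
def Indecomposable (G : GameForm) : Prop := ¬ Decomposable G

end GameForm

/-!
Nimbers add by xor, so if `k` has leading power `2 ^ n < k` then `*k = *(2 ^ n) + *(k - 2 ^ n)` is a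
decomposition.

Conversely, let `X` and `Y` be canonical of height less than `2 ^ n`; the claim is that
`X = Y + *k` is impossible when the leading power of `k` is `2 ^ n`. In a minimal counterexample,
all such `*k` compare in the same way with the differences of smaller forms, and this forces
`k = 2 ^ n`. As `X ≰ Y + *m` for `m = 2 ^ n - 1`, a Left option of `X` or a Right option of `Y`
witnesses this, and minimality and canonicity make that option equal to `Y + *m` or `X + *m`. So `X`
or `Y` has an option which is its own translate by `*(2 ^ n + m)`. But a canonical form `Z` equal to
`Y + *(2 ^ n + m)` that is lower than `Y` must have a Left option equal to `Y + *(2 ^ n + m - 1)`,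
and so on down to `Y + *(2 ^ n)`. Hence `Z` has height at least `m` and `Y` has height at least
`2 ^ n`.
-/

namespace GameForm

section Options

/-- The set of Left options, which forgets their indexing. -/
def leftOptions (G : GameForm) : Set GameForm := Set.range G.left

/-- The set of Right options, which forgets their indexing. -/
def rightOptions (G : GameForm) : Set GameForm := Set.range G.right

variable {A B G H : GameForm}

theorem height_lt_of_mem_leftOptions (hA : A ∈ G.leftOptions) : A.height < G.height := by
  obtain ⟨i, rfl⟩ := hA
  exact height_left_lt G i

theorem height_lt_of_mem_rightOptions (hB : B ∈ G.rightOptions) : B.height < G.height := by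
  obtain ⟨j, rfl⟩ := hB
  exact height_right_lt G j

instance : Preorder GameForm where
  le_refl := le_refl'
  le_trans := le_trans'

theorem le_iff_forall_options :
    G ≤ H ↔ (∀ A ∈ G.leftOptions, ¬ H ≤ A) ∧ ∀ B ∈ H.rightOptions, ¬ B ≤ G := by
  rw [le_iff, leftOptions, rightOptions, Set.forall_mem_range, Set.forall_mem_range]

theorem exists_option_of_not_le (h : ¬ G ≤ H) :
    (∃ A ∈ G.leftOptions, H ≤ A) ∨ ∃ B ∈ H.rightOptions, B ≤ G := by
  by_contra! hc
  exact h (le_iff_forall_options.2 hc)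

theorem not_le_of_mem_leftOptions (hA : A ∈ G.leftOptions) : ¬ G ≤ A :=
  (le_iff_forall_options.1 le_rfl).1 A hA

theorem not_le_of_mem_rightOptions (hB : B ∈ G.rightOptions) : ¬ B ≤ G :=
  (le_iff_forall_options.1 le_rfl).2 B hB

end Options

section Add

theorem range_finAppend {α : Type*} {m n : ℕ} (f : Fin m → α) (g : Fin n → α) :
    Set.range (Fin.append f g) = Set.range f ∪ Set.range g := by
  rw [← Set.Sum.elim_range, ← Fin.append_comp_sumElim]
  exact (finSumFinEquiv.surjective.range_comp _).symm

theorem leftOptions_add (G H : GameForm) :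
    (G + H).leftOptions = (· + H) '' G.leftOptions ∪ (G + ·) '' H.leftOptions := by
  rw [leftOptions, leftOptions, leftOptions, ← Set.range_comp, ← Set.range_comp, add_def]
  exact range_finAppend _ _

theorem rightOptions_add (G H : GameForm) :
    (G + H).rightOptions = (· + H) '' G.rightOptions ∪ (G + ·) '' H.rightOptions := by
  rw [rightOptions, rightOptions, rightOptions, ← Set.range_comp, ← Set.range_comp, add_def]
  exact range_finAppend _ _

variable {A B G H : GameForm}

theorem forall_mem_leftOptions_add {P : GameForm → Prop} :
    (∀ A ∈ (G + H).leftOptions, P A) ↔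
      (∀ A ∈ G.leftOptions, P (A + H)) ∧ ∀ A ∈ H.leftOptions, P (G + A) := by
  simp only [leftOptions_add, Set.mem_union, or_imp, forall_and, Set.forall_mem_image]

theorem forall_mem_rightOptions_add {P : GameForm → Prop} :
    (∀ B ∈ (G + H).rightOptions, P B) ↔
      (∀ B ∈ G.rightOptions, P (B + H)) ∧ ∀ B ∈ H.rightOptions, P (G + B) := by
  simp only [rightOptions_add, Set.mem_union, or_imp, forall_and, Set.forall_mem_image]

theorem add_right_mem_leftOptions (hA : A ∈ G.leftOptions) (H : GameForm) :
    A + H ∈ (G + H).leftOptions :=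
  (forall_mem_leftOptions_add.1 fun _ => id).1 A hA

theorem add_left_mem_leftOptions (G : GameForm) (hA : A ∈ H.leftOptions) :
    G + A ∈ (G + H).leftOptions :=
  (forall_mem_leftOptions_add.1 fun _ => id).2 A hA

theorem add_right_mem_rightOptions (hB : B ∈ G.rightOptions) (H : GameForm) :
    B + H ∈ (G + H).rightOptions :=
  (forall_mem_rightOptions_add.1 fun _ => id).1 B hB

theorem add_left_mem_rightOptions (G : GameForm) (hB : B ∈ H.rightOptions) :
    G + B ∈ (G + H).rightOptions :=
  (forall_mem_rightOptions_add.1 fun _ => id).2 B hB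

theorem add_le_add_comm (G H : GameForm) : G + H ≤ H + G := by
  rw [le_iff_forall_options, forall_mem_leftOptions_add, forall_mem_rightOptions_add]
  refine ⟨⟨fun A hA h => ?_, fun A hA h => ?_⟩, fun B hB h => ?_, fun B hB h => ?_⟩
  · have := height_lt_of_mem_leftOptions hA
    exact not_le_of_mem_leftOptions (add_left_mem_leftOptions H hA)
      (h.trans (add_le_add_comm A H))
  · have := height_lt_of_mem_leftOptions hA
    exact not_le_of_mem_leftOptions (add_right_mem_leftOptions hA G)
      (h.trans (add_le_add_comm G A))
  · have := height_lt_of_mem_rightOptions hB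
    exact not_le_of_mem_rightOptions (add_left_mem_rightOptions G hB)
      ((add_le_add_comm G B).trans h)
  · have := height_lt_of_mem_rightOptions hB
    exact not_le_of_mem_rightOptions (add_right_mem_rightOptions hB H)
      ((add_le_add_comm B H).trans h)
termination_by G.height + H.height

protected theorem add_le_add_right {G H : GameForm} (h : G ≤ H) (K : GameForm) :
    G + K ≤ H + K := by
  rw [le_iff_forall_options, forall_mem_leftOptions_add, forall_mem_rightOptions_add]
  refine ⟨⟨fun A hA hle => ?_, fun A hA hle => ?_⟩, fun B hB hle => ?_, fun B hB hle => ?_⟩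
  · have := height_lt_of_mem_leftOptions hA
    rcases exists_option_of_not_le ((le_iff_forall_options.1 h).1 A hA) with
      ⟨A', hA', hAA'⟩ | ⟨B, hB, hBH⟩
    · have := height_lt_of_mem_leftOptions hA'
      exact not_le_of_mem_leftOptions (add_right_mem_leftOptions hA' K)
        (hle.trans (GameForm.add_le_add_right hAA' K))
    · have := height_lt_of_mem_rightOptions hB
      exact not_le_of_mem_rightOptions (add_right_mem_rightOptions hB K)
        ((GameForm.add_le_add_right hBH K).trans hle)
  · have := height_lt_of_mem_leftOptions hA
    exact not_le_of_mem_leftOptions (add_left_mem_leftOptions H hA)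
      (hle.trans (GameForm.add_le_add_right h A))
  · have := height_lt_of_mem_rightOptions hB
    rcases exists_option_of_not_le ((le_iff_forall_options.1 h).2 B hB) with
      ⟨A, hA, hGA⟩ | ⟨B', hB', hBB'⟩
    · have := height_lt_of_mem_leftOptions hA
      exact not_le_of_mem_leftOptions (add_right_mem_leftOptions hA K)
        (hle.trans (GameForm.add_le_add_right hGA K))
    · have := height_lt_of_mem_rightOptions hB'
      exact not_le_of_mem_rightOptions (add_right_mem_rightOptions hB' K)
        ((GameForm.add_le_add_right hBB' K).trans hle)
  · have := height_lt_of_mem_rightOptions hB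
    exact not_le_of_mem_rightOptions (add_left_mem_rightOptions G hB)
      ((GameForm.add_le_add_right h B).trans hle)
termination_by G.height + H.height + K.height

protected theorem add_le_add {G' H' : GameForm} (h : G ≤ G') (h' : H ≤ H') :
    G + H ≤ G' + H' :=
  calc
    G + H ≤ G' + H := GameForm.add_le_add_right h H
    _ ≤ H + G' := add_le_add_comm G' H
    _ ≤ H' + G' := GameForm.add_le_add_right h' G'
    _ ≤ G' + H' := add_le_add_comm H' G'

theorem add_assoc_le (G H K : GameForm) : G + H + K ≤ G + (H + K) := by
  rw [le_iff_forall_options]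
  simp only [forall_mem_leftOptions_add, forall_mem_rightOptions_add]
  refine ⟨⟨⟨fun A hA h => ?_, fun A hA h => ?_⟩, fun A hA h => ?_⟩,
    fun B hB h => ?_, fun B hB h => ?_, fun B hB h => ?_⟩
  · have := height_lt_of_mem_leftOptions hA
    exact not_le_of_mem_leftOptions (add_right_mem_leftOptions hA (H + K))
      (h.trans (add_assoc_le A H K))
  · have := height_lt_of_mem_leftOptions hA
    exact not_le_of_mem_leftOptions (add_left_mem_leftOptions G (add_right_mem_leftOptions hA K))
      (h.trans (add_assoc_le G A K))
  · have := height_lt_of_mem_leftOptions hA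
    exact not_le_of_mem_leftOptions (add_left_mem_leftOptions G (add_left_mem_leftOptions H hA))
      (h.trans (add_assoc_le G H A))
  · have := height_lt_of_mem_rightOptions hB
    exact not_le_of_mem_rightOptions
      (add_right_mem_rightOptions (add_right_mem_rightOptions hB H) K)
      ((add_assoc_le B H K).trans h)
  · have := height_lt_of_mem_rightOptions hB
    exact not_le_of_mem_rightOptions
      (add_right_mem_rightOptions (add_left_mem_rightOptions G hB) K)
      ((add_assoc_le G B K).trans h)
  · have := height_lt_of_mem_rightOptions hB
    exact not_le_of_mem_rightOptions (add_left_mem_rightOptions (G + H) hB)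
      ((add_assoc_le G H B).trans h)
termination_by G.height + H.height + K.height

theorem le_add_assoc (G H K : GameForm) : G + (H + K) ≤ G + H + K :=
  calc
    G + (H + K) ≤ K + H + G :=
      (GameForm.add_le_add le_rfl (add_le_add_comm H K)).trans (add_le_add_comm _ _)
    _ ≤ K + (H + G) := add_assoc_le K H G
    _ ≤ G + H + K :=
      (GameForm.add_le_add le_rfl (add_le_add_comm H G)).trans (add_le_add_comm _ _)

instance : Zero GameForm := ⟨nimber 0⟩

theorem leftOptions_nimber (n : ℕ) : (nimber n).leftOptions = nimber '' Set.Iio n := by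
  rw [nimber]
  exact (Set.range_comp nimber Fin.val).trans (congrArg _ Fin.range_val)

theorem rightOptions_nimber (n : ℕ) : (nimber n).rightOptions = nimber '' Set.Iio n := by
  rw [nimber]
  exact (Set.range_comp nimber Fin.val).trans (congrArg _ Fin.range_val)

theorem leftOptions_zero : (0 : GameForm).leftOptions = ∅ :=
  (leftOptions_nimber 0).trans (by simp)

theorem rightOptions_zero : (0 : GameForm).rightOptions = ∅ :=
  (rightOptions_nimber 0).trans (by simp)

theorem le_zero_iff : G ≤ 0 ↔ ∀ A ∈ G.leftOptions, ¬ 0 ≤ A := by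
  simp only [le_iff_forall_options (H := 0), rightOptions_zero, Set.mem_empty_iff_false,
    IsEmpty.forall_iff, implies_true, and_true]

theorem zero_le_iff : 0 ≤ G ↔ ∀ B ∈ G.rightOptions, ¬ B ≤ 0 := by
  simp only [le_iff_forall_options (G := 0), leftOptions_zero, Set.mem_empty_iff_false,
    IsEmpty.forall_iff, implies_true, true_and]

theorem add_zero_le (G : GameForm) : G + 0 ≤ G := by
  rw [le_iff_forall_options, forall_mem_leftOptions_add, leftOptions_zero]
  refine ⟨⟨fun A hA h => ?_, fun A hA => hA.elim⟩, fun B hB h => ?_⟩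
  · have := height_lt_of_mem_leftOptions hA
    exact not_le_of_mem_leftOptions hA (h.trans (add_zero_le A))
  · have := height_lt_of_mem_rightOptions hB
    exact not_le_of_mem_rightOptions (add_right_mem_rightOptions hB 0) ((add_zero_le B).trans h)
termination_by G.height

theorem le_add_zero (G : GameForm) : G ≤ G + 0 := by
  rw [le_iff_forall_options, forall_mem_rightOptions_add, rightOptions_zero]
  refine ⟨fun A hA h => ?_, fun B hB h => ?_, fun B hB => hB.elim⟩
  · have := height_lt_of_mem_leftOptions hA
    exact not_le_of_mem_leftOptions (add_right_mem_leftOptions hA 0) (h.trans (le_add_zero A))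
  · have := height_lt_of_mem_rightOptions hB
    exact not_le_of_mem_rightOptions hB ((le_add_zero B).trans h)
termination_by G.height

end Add

section Neg

/-- The negative of a form, in which the players exchange roles. -/
protected def neg : GameForm → GameForm
  | mk m n L R => mk n m (fun j => GameForm.neg (R j)) (fun i => GameForm.neg (L i))

instance : Neg GameForm := ⟨GameForm.neg⟩

theorem leftOptions_neg (G : GameForm) : (-G).leftOptions = Neg.neg '' G.rightOptions := by
  cases G
  exact Set.range_comp _ _

theorem rightOptions_neg (G : GameForm) : (-G).rightOptions = Neg.neg '' G.leftOptions := by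
  cases G
  exact Set.range_comp _ _

variable {A B G : GameForm}

theorem neg_mem_leftOptions_neg (hB : B ∈ G.rightOptions) : -B ∈ (-G).leftOptions :=
  leftOptions_neg G ▸ Set.mem_image_of_mem _ hB

theorem neg_mem_rightOptions_neg (hA : A ∈ G.leftOptions) : -A ∈ (-G).rightOptions :=
  rightOptions_neg G ▸ Set.mem_image_of_mem _ hA

protected theorem neg_le_neg_iff {G H : GameForm} : -G ≤ -H ↔ H ≤ G := by
  rw [le_iff_forall_options, le_iff_forall_options, leftOptions_neg, rightOptions_neg,
    Set.forall_mem_image, Set.forall_mem_image, and_comm]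
  refine and_congr (forall₂_congr fun A hA => not_congr ?_)
    (forall₂_congr fun B hB => not_congr ?_)
  · have := height_lt_of_mem_leftOptions hA
    exact GameForm.neg_le_neg_iff
  · have := height_lt_of_mem_rightOptions hB
    exact GameForm.neg_le_neg_iff
termination_by G.height + H.height

theorem add_neg_le_zero (G : GameForm) : G + -G ≤ 0 := by
  rw [le_zero_iff, forall_mem_leftOptions_add, leftOptions_neg, Set.forall_mem_image]
  refine ⟨fun A hA h => ?_, fun B hB h => ?_⟩
  · have := height_lt_of_mem_leftOptions hA
    exact zero_le_iff.1 h _ (add_left_mem_rightOptions A (neg_mem_rightOptions_neg hA))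
      (add_neg_le_zero A)
  · have := height_lt_of_mem_rightOptions hB
    exact zero_le_iff.1 h _ (add_right_mem_rightOptions hB (-B)) (add_neg_le_zero B)
termination_by G.height

theorem zero_le_add_neg (G : GameForm) : 0 ≤ G + -G := by
  rw [zero_le_iff, forall_mem_rightOptions_add, rightOptions_neg, Set.forall_mem_image]
  refine ⟨fun B hB h => ?_, fun A hA h => ?_⟩
  · have := height_lt_of_mem_rightOptions hB
    exact le_zero_iff.1 h _ (add_left_mem_leftOptions B (neg_mem_leftOptions_neg hB))
      (zero_le_add_neg B)
  · have := height_lt_of_mem_leftOptions hA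
    exact le_zero_iff.1 h _ (add_right_mem_leftOptions hA (-A)) (zero_le_add_neg A)
termination_by G.height

theorem neg_nimber (n : ℕ) : -nimber n = nimber n := by
  rw [nimber]
  exact congrArg (fun f => mk n n f f) (funext fun i => neg_nimber i)

theorem height_neg (G : GameForm) : (-G).height = G.height := by
  induction G with
  | mk m n L R ihL ihR =>
    change max _ _ = max _ _
    rw [max_comm]
    exact congrArg₂ max (Finset.sup_congr rfl fun i _ => congrArg (· + 1) (ihL i))
      (Finset.sup_congr rfl fun j _ => congrArg (· + 1) (ihR j))

end Neg

section Value

/-- Game values: forms up to `Equal`, which is the equivalence of the preorder of forms. -/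
def Value : Type := Antisymmetrization GameForm (· ≤ ·)

/-- The value of a form. -/
def val (G : GameForm) : Value := toAntisymmetrization (· ≤ ·) G

namespace Value

instance : PartialOrder Value :=
  inferInstanceAs (PartialOrder (Antisymmetrization GameForm (· ≤ ·)))

instance : Zero Value := ⟨val 0⟩

instance : Add Value :=
  ⟨Quotient.map₂ (· + ·) fun _ _ h _ _ h' =>
    ⟨GameForm.add_le_add h.1 h'.1, GameForm.add_le_add h.2 h'.2⟩⟩

instance : Neg Value :=
  ⟨Quotient.map Neg.neg fun _ _ h =>
    ⟨GameForm.neg_le_neg_iff.2 h.2, GameForm.neg_le_neg_iff.2 h.1⟩⟩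

instance : AddCommGroup Value :=
  have add_comm' : ∀ x y : Value, x + y = y + x := by
    rintro ⟨G⟩ ⟨H⟩
    exact Quotient.sound ⟨add_le_add_comm G H, add_le_add_comm H G⟩
  have add_zero' : ∀ x : Value, x + 0 = x := by
    rintro ⟨G⟩
    exact Quotient.sound ⟨add_zero_le G, le_add_zero G⟩
  have add_neg_cancel' : ∀ x : Value, x + -x = 0 := by
    rintro ⟨G⟩
    exact Quotient.sound ⟨add_neg_le_zero G, zero_le_add_neg G⟩
  { add_assoc := by
      rintro ⟨G⟩ ⟨H⟩ ⟨K⟩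
      exact Quotient.sound ⟨add_assoc_le G H K, le_add_assoc G H K⟩
    zero_add := fun x => (add_comm' 0 x).trans (add_zero' x)
    add_zero := add_zero'
    nsmul := nsmulRec
    zsmul := zsmulRec
    neg_add_cancel := fun x => (add_comm' (-x) x).trans (add_neg_cancel' x)
    add_comm := add_comm' }

instance : IsOrderedAddMonoid Value where
  add_le_add_left := by
    rintro ⟨G⟩ ⟨H⟩ h ⟨K⟩
    exact GameForm.add_le_add_right h K

end Value

variable {G H : GameForm}

theorem val_le_iff : val G ≤ val H ↔ G ≤ H := Iff.rfl

theorem val_eq_iff : val G = val H ↔ Equal G H := Quotient.eq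

theorem val_add (G H : GameForm) : val (G + H) = val G + val H := rfl

theorem val_neg (G : GameForm) : val (-G) = -val G := rfl

theorem val_canonicalForm (G : GameForm) : val G.canonicalForm = val G :=
  val_eq_iff.2 (canonicalForm_spec G).2

end Value

section Nim

/-- The value of the nimber `*n`. -/
def nim (n : ℕ) : Value := val (nimber n)

theorem nim_zero : nim 0 = 0 := rfl

theorem neg_nim (n : ℕ) : -nim n = nim n := congrArg val (neg_nimber n)

variable {a b k m n : ℕ} {x y z : Value} {X Y : GameForm}

theorem nimber_mem_leftOptions (h : m < n) : nimber m ∈ (nimber n).leftOptions :=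
  leftOptions_nimber n ▸ Set.mem_image_of_mem _ h

theorem nimber_mem_rightOptions (h : m < n) : nimber m ∈ (nimber n).rightOptions :=
  rightOptions_nimber n ▸ Set.mem_image_of_mem _ h

theorem nim_le_nim_iff : nim m ≤ nim n ↔ m = n := by
  refine ⟨fun h => ?_, fun h => h ▸ le_rfl⟩
  rcases lt_trichotomy m n with hlt | heq | hlt
  · exact absurd h (not_le_of_mem_rightOptions (nimber_mem_rightOptions hlt))
  · exact heq
  · exact absurd h (not_le_of_mem_leftOptions (nimber_mem_leftOptions hlt))

theorem nim_add_nim_le (ha : ∀ m < a, nim m + nim b = nim (m ^^^ b))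
    (hb : ∀ m < b, nim a + nim m = nim (a ^^^ m)) : nim a + nim b ≤ nim (a ^^^ b) := by
  rw [nim, nim, nim, ← val_add, val_le_iff, le_iff_forall_options, forall_mem_leftOptions_add,
    leftOptions_nimber, leftOptions_nimber, rightOptions_nimber, Set.forall_mem_image,
    Set.forall_mem_image, Set.forall_mem_image]
  refine ⟨⟨fun m hm h => ?_, fun m hm h => ?_⟩, fun c hc h => ?_⟩
  · have h' : nim (a ^^^ b) ≤ nim (m ^^^ b) := h.trans (ha m hm).le
    exact hm.ne' (Nat.xor_left_inj.1 (nim_le_nim_iff.1 h'))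
  · have h' : nim (a ^^^ b) ≤ nim (a ^^^ m) := h.trans (hb m hm).le
    exact hm.ne' (Nat.xor_right_inj.1 (nim_le_nim_iff.1 h'))
  · rcases Nat.lt_xor_cases hc with hlt | hlt
    · have hle : nim (c ^^^ b) + nim b ≤ nim a + nim b := by
        rw [ha _ hlt, Nat.xor_xor_cancel_right]
        exact h
      exact not_le_of_mem_rightOptions
        (add_right_mem_rightOptions (nimber_mem_rightOptions hlt) (nimber b)) hle
    · have hle : nim a + nim (c ^^^ a) ≤ nim a + nim b := by
        rw [hb _ hlt, Nat.xor_comm c, Nat.xor_xor_cancel_left]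
        exact h
      exact not_le_of_mem_rightOptions
        (add_left_mem_rightOptions (nimber a) (nimber_mem_rightOptions hlt)) hle

theorem nim_add_nim (a b : ℕ) : nim a + nim b = nim (a ^^^ b) := by
  have hle : nim a + nim b ≤ nim (a ^^^ b) :=
    nim_add_nim_le (fun m _ => nim_add_nim m b) (fun m _ => nim_add_nim a m)
  refine hle.antisymm ?_
  have hneg := neg_le_neg hle
  rwa [neg_add, neg_nim, neg_nim, neg_nim] at hneg
termination_by a + b

theorem add_nim_add_nim (x : Value) (a b : ℕ) : x + nim a + nim b = x + nim (a ^^^ b) := by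
  rw [add_assoc, nim_add_nim]

theorem add_nim_le_iff : x + nim k ≤ y ↔ x ≤ y + nim k := by
  rw [← le_sub_iff_add_le, sub_eq_add_neg, neg_nim]

theorem eq_add_nim_comm : x = y + nim k ↔ y = x + nim k := by
  rw [← sub_eq_iff_eq_add, sub_eq_add_neg, neg_nim, eq_comm]

theorem add_nim_le_add_nim_iff : x + nim a ≤ x + nim b ↔ a = b := by
  rw [add_le_add_iff_left, nim_le_nim_iff]

theorem add_nim_le_trans (h : x + nim a ≤ y) (h' : y + nim b ≤ z) : x + nim (a ^^^ b) ≤ z := by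
  rw [← add_nim_add_nim]
  exact (add_le_add_left h _).trans h'

theorem exists_of_not_val_le_add_nim (h : ¬ val X ≤ val Y + nim k) :
    (∃ A ∈ X.leftOptions, val Y + nim k ≤ val A) ∨
      (∃ B ∈ Y.rightOptions, val B + nim k ≤ val X) ∨ ∃ m < k, val Y + nim m ≤ val X := by
  rcases exists_option_of_not_le (G := X) (H := Y + nimber k) h with hA | ⟨B, hB, hBX⟩
  · exact Or.inl hA
  · rw [rightOptions_add, rightOptions_nimber] at hB
    obtain ⟨B', hB', rfl⟩ | ⟨_, ⟨m, hm, rfl⟩, rfl⟩ := hB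
    · exact Or.inr (Or.inl ⟨B', hB', hBX⟩)
    · exact Or.inr (Or.inr ⟨m, hm, hBX⟩)

end Nim

section Canonical

variable {A A' B G : GameForm}

theorem isCanonical_mk {m n : ℕ} {L : Fin m → GameForm} {R : Fin n → GameForm} :
    IsCanonical (mk m n L R) ↔
      (∀ i i', i ≠ i' → ¬ L i ≤ L i') ∧ (∀ j j', j ≠ j' → ¬ R j ≤ R j') ∧
      (∀ i, ∀ B ∈ (L i).rightOptions, ¬ B ≤ mk m n L R) ∧
      (∀ j, ∀ A ∈ (R j).leftOptions, ¬ mk m n L R ≤ A) ∧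
      (∀ i, IsCanonical (L i)) ∧ ∀ j, IsCanonical (R j) := by
  rw [IsCanonical]
  simp only [leftOptions, rightOptions, Set.forall_mem_range]
  rfl

theorem IsCanonical.of_mem_leftOptions (hG : IsCanonical G) (hA : A ∈ G.leftOptions) :
    IsCanonical A := by
  rw [IsCanonical] at hG
  exact Set.forall_mem_range.2 hG.2.2.2.2.1 A hA

theorem IsCanonical.of_mem_rightOptions (hG : IsCanonical G) (hB : B ∈ G.rightOptions) :
    IsCanonical B := by
  rw [IsCanonical] at hG
  exact Set.forall_mem_range.2 hG.2.2.2.2.2 B hB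

theorem IsCanonical.eq_of_le (hG : IsCanonical G) (hA : A ∈ G.leftOptions)
    (hA' : A' ∈ G.leftOptions) (h : A ≤ A') : A = A' := by
  rw [IsCanonical] at hG
  obtain ⟨i, rfl⟩ := hA
  obtain ⟨i', rfl⟩ := hA'
  by_contra hne
  exact hG.1 i i' (fun hi => hne (congrArg G.left hi)) h

theorem IsCanonical.not_le_of_mem_rightOptions (hG : IsCanonical G) (hA : A ∈ G.leftOptions)
    (hB : B ∈ A.rightOptions) : ¬ B ≤ G := by
  rw [IsCanonical] at hG
  obtain ⟨i, rfl⟩ := hA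
  obtain ⟨k, rfl⟩ := hB
  exact hG.2.2.1 i k

theorem IsCanonical.neg (hG : IsCanonical G) : IsCanonical (-G) := by
  induction G with
  | mk m n L R ihL ihR =>
    obtain ⟨hL, hR, hLR, hRL, hcL, hcR⟩ := isCanonical_mk.1 hG
    refine isCanonical_mk.2 ⟨fun j j' hne h => ?_, fun i i' hne h => ?_, fun j => ?_, fun i => ?_,
      fun j => ihR j (hcR j), fun i => ihL i (hcL i)⟩
    · exact hR j' j hne.symm (GameForm.neg_le_neg_iff.1 h)
    · exact hL i' i hne.symm (GameForm.neg_le_neg_iff.1 h)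
    · change ∀ B ∈ (-R j).rightOptions, ¬ B ≤ -mk m n L R
      rw [rightOptions_neg, Set.forall_mem_image]
      exact fun A hA h => hRL j A hA (GameForm.neg_le_neg_iff.1 h)
    · change ∀ A ∈ (-L i).leftOptions, ¬ -mk m n L R ≤ A
      rw [leftOptions_neg, Set.forall_mem_image]
      exact fun B hB h => hLR i B hB (GameForm.neg_le_neg_iff.1 h)

theorem isCanonical_nimber (n : ℕ) : IsCanonical (nimber n) := by
  have hle : ∀ {a b : ℕ}, nimber a ≤ nimber b → a = b := nim_le_nim_iff.1
  rw [nimber, isCanonical_mk, ← nimber]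
  refine ⟨fun i i' hne h => hne (Fin.ext (hle h)), fun j j' hne h => hne (Fin.ext (hle h)),
    fun i => ?_, fun j => ?_, fun i => isCanonical_nimber i, fun j => isCanonical_nimber j⟩
  · rw [rightOptions_nimber, Set.forall_mem_image]
    exact fun m hm h => (hm.trans i.2).ne (hle h)
  · rw [leftOptions_nimber, Set.forall_mem_image]
    exact fun m hm h => (hm.trans j.2).ne' (hle h)

theorem height_le_iff_forall_options {b : ℕ} : G.height ≤ b ↔
    (∀ A ∈ G.leftOptions, A.height < b) ∧ ∀ B ∈ G.rightOptions, B.height < b := by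
  rw [height_le_iff, leftOptions, rightOptions, Set.forall_mem_range, Set.forall_mem_range]

theorem height_nimber (n : ℕ) : (nimber n).height = n := by
  refine eq_of_forall_ge_iff fun b => ?_
  rw [height_le_iff_forall_options, leftOptions_nimber, rightOptions_nimber, and_self,
    Set.forall_mem_image]
  refine Iff.trans (forall₂_congr fun m hm => ?_) forall_lt_iff_le
  have : m < n := hm
  rw [height_nimber m]

theorem birthday_nimber (n : ℕ) : (nimber n).birthday = n :=
  (birthday_eq _ _ (isCanonical_nimber n) (Equal.refl _)).trans (height_nimber n)

end Canonical

section Binary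

/-- The leading binary digit of `k` is the one of weight `2 ^ n`. -/
def HasTopBit (n k : ℕ) : Prop := 2 ^ n ≤ k ∧ k < 2 ^ (n + 1)

variable {n k m : ℕ}

theorem hasTopBit_iff_shiftRight : HasTopBit n k ↔ k >>> n = 1 := by
  rw [HasTopBit, Nat.shiftRight_eq_div_pow, Nat.div_eq_iff (Nat.two_pow_pos n), pow_succ]
  have := Nat.two_pow_pos n
  omega

theorem hasTopBit_two_pow (n : ℕ) : HasTopBit n (2 ^ n) :=
  ⟨le_rfl, Nat.pow_lt_pow_succ one_lt_two⟩

theorem HasTopBit.xor_of_lt (hk : HasTopBit n k) (hm : m < 2 ^ n) : HasTopBit n (k ^^^ m) := by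
  rw [hasTopBit_iff_shiftRight] at hk ⊢
  rw [Nat.shiftRight_xor_distrib, hk, Nat.shiftRight_eq_zero m n hm, Nat.xor_zero]

theorem two_pow_xor_of_lt (hm : m < 2 ^ n) : 2 ^ n ^^^ m = 2 ^ n + m := by
  rw [← mul_one (2 ^ n), Nat.two_pow_add_eq_or_of_lt hm, mul_one]
  refine Nat.eq_of_testBit_eq fun i => ?_
  rw [Nat.testBit_xor, Nat.testBit_or, Nat.testBit_two_pow]
  grind [Nat.testBit_lt_two_pow]

theorem two_pow_add_two_pow_le {a b c : ℕ} (ha : a < c) (hb : b < c) : 2 ^ a + 2 ^ b ≤ 2 ^ c := by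
  have ha' : 2 ^ (a + 1) ≤ 2 ^ c := Nat.pow_le_pow_right two_pos ha
  have hb' : 2 ^ (b + 1) ≤ 2 ^ c := Nat.pow_le_pow_right two_pos hb
  omega

end Binary

section NimTranslate

/-- Two canonical forms that are low, as measured by `M`, never differ by a nimber `*k` with
leading binary digit of weight `2 ^ n`. The pair `X`, `Y` is weighed by
`2 ^ X.height + 2 ^ Y.height` since this decreases both when one form is replaced by an option and
when both are replaced by forms lower than the higher one. -/
def NoNimTranslate (n M : ℕ) : Prop :=
  ∀ ⦃X Y : GameForm⦄, IsCanonical X → IsCanonical Y → 2 ^ X.height + 2 ^ Y.height < M →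
    ∀ ⦃k⦄, HasTopBit n k → val X ≠ val Y + nim k

namespace NoNimTranslate

variable {n M k k' m : ℕ} {X Y Z A B C : GameForm}

theorem add_nim_le {X Y : GameForm} {k k' : ℕ} (hM : NoNimTranslate n M) (hX : IsCanonical X)
    (hY : IsCanonical Y) (hXY : 2 ^ X.height + 2 ^ Y.height < M) (hk : HasTopBit n k)
    (hk' : HasTopBit n k') (h : val X + nim k ≤ val Y) : val X + nim k' ≤ val Y := by
  rw [add_nim_le_iff]
  by_contra hc
  rcases exists_of_not_val_le_add_nim hc with ⟨A, hA, hYA⟩ | ⟨B, hB, hBX⟩ | ⟨m, hm, hYX⟩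
  · have hlt := height_lt_of_mem_leftOptions hA
    have hlt' := Nat.pow_lt_pow_right one_lt_two hlt
    have hYA' := hM.add_nim_le hY (hX.of_mem_leftOptions hA) (by omega) hk' hk hYA
    exact not_le_of_mem_leftOptions hA ((add_nim_le_iff.1 h).trans hYA')
  · have hlt := height_lt_of_mem_rightOptions hB
    have hlt' := Nat.pow_lt_pow_right one_lt_two hlt
    have hBX' := hM.add_nim_le (hY.of_mem_rightOptions hB) hX (by omega) hk' hk hBX
    exact not_le_of_mem_rightOptions hB ((add_nim_le_iff.1 hBX').trans h)
  · rw [add_nim_le_iff] at hYX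
    obtain rfl := add_nim_le_add_nim_iff.1 (h.trans hYX)
    exact hM hY hX (by omega) hk (hYX.antisymm h)
termination_by X.height + Y.height

theorem eq_two_pow (hM : NoNimTranslate n M) (hX : IsCanonical X) (hY : IsCanonical Y)
    (hXY : 2 ^ X.height + 2 ^ Y.height ≤ M) (hk : HasTopBit n k) (h : val X = val Y + nim k) :
    k = 2 ^ n := by
  by_contra hne
  have hn := hasTopBit_two_pow n
  have hc : ¬ val X ≤ val Y + nim (2 ^ n) := by rwa [h, add_nim_le_add_nim_iff]
  rcases exists_of_not_val_le_add_nim hc with ⟨A, hA, hYA⟩ | ⟨B, hB, hBX⟩ | ⟨m, hm, hYX⟩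
  · have hlt := Nat.pow_lt_pow_right one_lt_two (height_lt_of_mem_leftOptions hA)
    have hYA' := hM.add_nim_le hY (hX.of_mem_leftOptions hA) (by omega) hn hk hYA
    exact not_le_of_mem_leftOptions hA (h.trans_le hYA')
  · have hlt := Nat.pow_lt_pow_right one_lt_two (height_lt_of_mem_rightOptions hB)
    have hBX' := hM.add_nim_le (hY.of_mem_rightOptions hB) hX (by omega) hn hk hBX
    rw [h, add_le_add_iff_right] at hBX'
    exact not_le_of_mem_rightOptions hB hBX'
  · rw [h, add_nim_le_add_nim_iff] at hYX
    exact (hm.trans_le hk.1).ne hYX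

theorem not_add_nim_le_of_mem_leftOptions (hM : NoNimTranslate n M) (hX : IsCanonical X)
    (hY : IsCanonical Y) (hXY : 2 ^ X.height + 2 ^ Y.height ≤ M) (hn : n ≠ 0)
    (h : val X = val Y + nim (2 ^ n)) (hA : A ∈ X.leftOptions)
    (hYA : val Y + nim m ≤ val A) (hC : C ∈ Y.leftOptions) :
    ¬ val A + nim (2 ^ n) ≤ val C := by
  intro hAC
  have h1 : 1 < 2 ^ n := Nat.one_lt_two_pow hn
  have hAX := Nat.pow_lt_pow_right one_lt_two (height_lt_of_mem_leftOptions hA)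
  have hCY := Nat.pow_lt_pow_right one_lt_two (height_lt_of_mem_leftOptions hC)
  have hAC' : ∀ d < 2 ^ n, val A + nim (2 ^ n ^^^ d) ≤ val C := fun d hd =>
    hM.add_nim_le (hX.of_mem_leftOptions hA) (hY.of_mem_leftOptions hC) (by omega)
      (hasTopBit_two_pow n) ((hasTopBit_two_pow n).xor_of_lt hd) hAC
  have hXC : ¬ val X ≤ val C + nim (2 ^ n) := by
    rw [h, add_le_add_iff_right]
    exact not_le_of_mem_leftOptions hC
  rcases exists_of_not_val_le_add_nim hXC with ⟨A', hA', hCA'⟩ | ⟨B, hB, hBX⟩ | ⟨m', -, hCX⟩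
  · have hAA' : ∀ d < 2 ^ n, val A + nim d ≤ val A' := fun d hd => by
      have := add_nim_le_trans (hAC' d hd) hCA'
      rwa [Nat.xor_comm (2 ^ n), Nat.xor_xor_cancel_right] at this
    have hle : val A ≤ val A' := by simpa only [nim_zero, add_zero] using hAA' 0 (by omega)
    obtain rfl := hX.eq_of_le hA hA' hle
    have hle_self : val A + nim 1 ≤ val A + nim 0 := by
      simpa only [nim_zero, add_zero] using hAA' 1 h1
    exact one_ne_zero (add_nim_le_add_nim_iff.1 hle_self)
  · rw [h, add_le_add_iff_right] at hBX
    exact hY.not_le_of_mem_rightOptions hC hB hBX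
  · have hxor : ∀ d < 2 ^ n, m ^^^ (2 ^ n ^^^ d) ^^^ m' = 2 ^ n := fun d hd =>
      add_nim_le_add_nim_iff.1
        ((add_nim_le_trans (add_nim_le_trans hYA (hAC' d hd)) hCX).trans_eq h)
    have h01 := (hxor 0 (by omega)).trans (hxor 1 h1).symm
    rw [Nat.xor_left_inj, Nat.xor_right_inj, Nat.xor_right_inj] at h01
    exact zero_ne_one h01

theorem eq_add_nim_of_mem_leftOptions (hM : NoNimTranslate n M) (hX : IsCanonical X)
    (hY : IsCanonical Y) (hXY : 2 ^ X.height + 2 ^ Y.height ≤ M) (hn : n ≠ 0)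
    (h : val X = val Y + nim (2 ^ n)) (hA : A ∈ X.leftOptions)
    (hYA : val Y + nim m ≤ val A) : val A = val Y + nim m := by
  have hc : ¬ val Y ≤ val A + nim (2 ^ n) := fun hle =>
    not_le_of_mem_leftOptions hA (h.trans_le (add_nim_le_iff.2 hle))
  rcases exists_of_not_val_le_add_nim hc with ⟨C, hC, hAC⟩ | ⟨B, hB, hBY⟩ | ⟨m', -, hAY⟩
  · exact absurd hAC (hM.not_add_nim_le_of_mem_leftOptions hX hY hXY hn h hA hYA hC)
  · exact absurd ((add_nim_le_iff.1 hBY).trans_eq h.symm) (hX.not_le_of_mem_rightOptions hA hB)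
  · rw [add_nim_le_iff] at hAY
    obtain rfl := add_nim_le_add_nim_iff.1 (hYA.trans hAY)
    exact hAY.antisymm hYA

theorem eq_add_nim_of_mem_rightOptions (hM : NoNimTranslate n M) (hX : IsCanonical X)
    (hY : IsCanonical Y) (hXY : 2 ^ X.height + 2 ^ Y.height ≤ M) (hn : n ≠ 0)
    (h : val X = val Y + nim (2 ^ n)) (hB : B ∈ Y.rightOptions)
    (hBX : val B + nim m ≤ val X) : val B = val X + nim m := by
  have hneg : val (-Y) = val (-X) + nim (2 ^ n) := by
    rw [val_neg, val_neg, eq_add_nim_comm, h, neg_add, neg_nim]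
  have hle : val (-X) + nim m ≤ val (-B) := by
    rw [val_neg, val_neg, add_nim_le_iff, ← neg_nim, ← neg_add]
    exact neg_le_neg hBX
  have heq := hM.eq_add_nim_of_mem_leftOptions hY.neg hX.neg
    (by rwa [height_neg, height_neg, add_comm]) hn hneg (neg_mem_leftOptions_neg hB) hle
  rwa [val_neg, val_neg, ← neg_nim, ← neg_add, neg_inj] at heq

theorem exists_mem_leftOptions_eq_add_nim (hM : NoNimTranslate n M) (hY : IsCanonical Y)
    (hYM : 2 ^ Y.height < M) (hZ : IsCanonical Z) (hZY : Z.height < Y.height)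
    (hk : HasTopBit n k) (hk' : HasTopBit n k') (hkk' : k' < k) (h : val Z = val Y + nim k) :
    ∃ C ∈ Z.leftOptions, val C = val Y + nim k' := by
  have hc : ¬ val Z ≤ val Y + nim k' := by
    rw [h, add_nim_le_add_nim_iff]
    exact hkk'.ne'
  rcases exists_of_not_val_le_add_nim hc with ⟨C, hC, hYC⟩ | ⟨B, hB, hBZ⟩ | ⟨m, hm, hYZ⟩
  · refine ⟨C, hC, ?_⟩
    have hc' : ¬ val Y ≤ val C + nim k := fun hle =>
      not_le_of_mem_leftOptions hC (h.trans_le (add_nim_le_iff.2 hle))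
    rcases exists_of_not_val_le_add_nim hc' with ⟨A, hA, hCA⟩ | ⟨B, hB, hBY⟩ | ⟨m, -, hCY⟩
    · have hlt := two_pow_add_two_pow_le ((height_lt_of_mem_leftOptions hC).trans hZY)
        (height_lt_of_mem_leftOptions hA)
      have hCA' := hM.add_nim_le (hZ.of_mem_leftOptions hC) (hY.of_mem_leftOptions hA)
        (by omega) hk hk' hCA
      have hYA := add_nim_le_trans hYC hCA'
      rw [Nat.xor_self, nim_zero, add_zero] at hYA
      exact absurd hYA (not_le_of_mem_leftOptions hA)
    · exact absurd ((add_nim_le_iff.1 hBY).trans_eq h.symm) (hZ.not_le_of_mem_rightOptions hC hB)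
    · rw [add_nim_le_iff] at hCY
      obtain rfl := add_nim_le_add_nim_iff.1 (hYC.trans hCY)
      exact hCY.antisymm hYC
  · have hlt := two_pow_add_two_pow_le (height_lt_of_mem_rightOptions hB) hZY
    have hBZ' := hM.add_nim_le (hY.of_mem_rightOptions hB) hZ (by omega) hk' hk hBZ
    rw [h, add_le_add_iff_right] at hBZ'
    exact absurd hBZ' (not_le_of_mem_rightOptions hB)
  · rw [h, add_nim_le_add_nim_iff] at hYZ
    omega

theorem le_two_pow_add_height {Z : GameForm} {k : ℕ} (hM : NoNimTranslate n M)
    (hY : IsCanonical Y) (hYM : 2 ^ Y.height < M) (hZ : IsCanonical Z)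
    (hZY : Z.height < Y.height) (hk : HasTopBit n k) (h : val Z = val Y + nim k) :
    k ≤ 2 ^ n + Z.height := by
  rcases hk.1.eq_or_lt with rfl | hlt
  · exact Nat.le_add_right _ _
  · have hk' : HasTopBit n (k - 1) := ⟨Nat.le_sub_one_of_lt hlt, (Nat.sub_le k 1).trans_lt hk.2⟩
    have hlt' : k - 1 < k := Nat.sub_one_lt (Nat.ne_zero_of_lt hlt)
    obtain ⟨C, hC, hCY⟩ := hM.exists_mem_leftOptions_eq_add_nim hY hYM hZ hZY hk hk' hlt' h
    have hCZ := height_lt_of_mem_leftOptions hC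
    have := hM.le_two_pow_add_height hY hYM (hZ.of_mem_leftOptions hC) (hCZ.trans hZY) hk' hCY
    omega
termination_by Z.height

theorem ne_add_nim_of_height_lt (hM : NoNimTranslate n M) (hY : IsCanonical Y)
    (hYM : 2 ^ Y.height < M) (hYn : Y.height < 2 ^ n) (hZ : IsCanonical Z)
    (hZY : Z.height < Y.height) : val Z ≠ val Y + nim (2 ^ n ^^^ (2 ^ n - 1)) := by
  intro h
  have hm : 2 ^ n - 1 < 2 ^ n := Nat.sub_one_lt (Nat.two_pow_pos n).ne'
  have := hM.le_two_pow_add_height hY hYM hZ hZY ((hasTopBit_two_pow n).xor_of_lt hm) h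
  rw [two_pow_xor_of_lt hm] at this
  omega

theorem ne_add_nim (hM : NoNimTranslate n M) (hMn : M ≤ 2 ^ 2 ^ n) (hX : IsCanonical X)
    (hY : IsCanonical Y) (hXY : 2 ^ X.height + 2 ^ Y.height ≤ M) (hk : HasTopBit n k) :
    val X ≠ val Y + nim k := by
  intro h
  obtain rfl := hM.eq_two_pow hX hY hXY hk h
  have hXM : 2 ^ X.height < M := by have := Nat.two_pow_pos Y.height; omega
  have hYM : 2 ^ Y.height < M := by have := Nat.two_pow_pos X.height; omega
  have hXn : X.height < 2 ^ n := (Nat.pow_lt_pow_iff_right one_lt_two).1 (hXM.trans_le hMn)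
  have hYn : Y.height < 2 ^ n := (Nat.pow_lt_pow_iff_right one_lt_two).1 (hYM.trans_le hMn)
  have hm : 2 ^ n - 1 < 2 ^ n := Nat.sub_one_lt (Nat.two_pow_pos n).ne'
  have hc : ¬ val X ≤ val Y + nim (2 ^ n - 1) := by
    rw [h, add_nim_le_add_nim_iff]
    exact hm.ne'
  rcases exists_of_not_val_le_add_nim hc with ⟨A, hA, hYA⟩ | ⟨B, hB, hBX⟩ | ⟨m, hm', hYX⟩
  · have hAX := height_lt_of_mem_leftOptions hA
    have hn : n ≠ 0 := by rintro rfl; omega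
    have hAY := hM.eq_add_nim_of_mem_leftOptions hX hY hXY hn h hA hYA
    rw [eq_add_nim_comm.1 h, add_nim_add_nim] at hAY
    exact hM.ne_add_nim_of_height_lt hX hXM hXn (hX.of_mem_leftOptions hA) hAX hAY
  · have hBY := height_lt_of_mem_rightOptions hB
    have hn : n ≠ 0 := by rintro rfl; omega
    have hBX' := hM.eq_add_nim_of_mem_rightOptions hX hY hXY hn h hB hBX
    rw [h, add_nim_add_nim] at hBX'
    exact hM.ne_add_nim_of_height_lt hY hYM hYn (hY.of_mem_rightOptions hB) hBY hBX'
  · rw [h, add_nim_le_add_nim_iff] at hYX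
    omega

end NoNimTranslate

theorem noNimTranslate {n M : ℕ} (hMn : M ≤ 2 ^ 2 ^ n + 1) : NoNimTranslate n M := by
  induction M with
  | zero => exact fun X Y _ _ h => absurd h (Nat.not_lt_zero _)
  | succ M ih =>
    exact fun X Y hX hY hXY k hk =>
      (ih (by omega)).ne_add_nim (by omega) hX hY (Nat.lt_succ_iff.1 hXY) hk

end NimTranslate

theorem indecomposable_nimber_two_pow (n : ℕ) : Indecomposable (nimber (2 ^ n)) := by
  rintro ⟨H, J, hH, hJ, h⟩
  rw [birthday_nimber] at hH hJ
  have hHJ : 2 ^ H.canonicalForm.height + 2 ^ (-J.canonicalForm).height ≤ 2 ^ 2 ^ n := by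
    rw [height_neg]
    exact two_pow_add_two_pow_le hH hJ
  refine noNimTranslate le_rfl (canonicalForm_spec H).1 (canonicalForm_spec J).1.neg
    (Nat.lt_succ_iff.2 hHJ) (hasTopBit_two_pow n) ?_
  rw [val_neg, val_canonicalForm, val_canonicalForm, eq_neg_add_iff_add_eq, add_comm]
  exact (val_eq_iff.2 h).symm

theorem decomposable_nimber {k : ℕ} (hk : k ≠ 0) (h : ∀ n, k ≠ 2 ^ n) :
    Decomposable (nimber k) := by
  obtain ⟨n, hn⟩ : ∃ n, HasTopBit n k :=
    ⟨Nat.log 2 k, Nat.pow_log_le_self 2 hk, Nat.lt_pow_succ_log_self one_lt_two k⟩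
  obtain ⟨b, rfl⟩ := Nat.exists_eq_add_of_le hn.1
  have hb : b < 2 ^ n := by have := hn.2; omega
  have hb0 : b ≠ 0 := by rintro rfl; exact h n rfl
  refine ⟨nimber (2 ^ n), nimber b, ?_, ?_, val_eq_iff.1 ?_⟩
  · rw [birthday_nimber, birthday_nimber]
    omega
  · rw [birthday_nimber, birthday_nimber]
    omega
  · change nim (2 ^ n + b) = nim (2 ^ n) + nim b
    rw [nim_add_nim, two_pow_xor_of_lt hb]

end GameForm

theorem mainTheorem1 (k : ℕ) (hk : k ≠ 0) :
    GameForm.Indecomposable (GameForm.nimber k) ↔ ∃ n : ℕ, k = 2 ^ n := by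
  refine ⟨fun h => ?_, ?_⟩
  · by_contra! hc
    exact h (GameForm.decomposable_nimber hk hc)
  · rintro ⟨n, rfl⟩
    exact GameForm.indecomposable_nimber_two_pow n
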